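/- For a partition $\lambda$ of length at most $k$, let $$P_\lambda(x_1,\dots,x_k;t)=\sum_{w\in S_k/S_k^\lambda} w\bigg(x_1^{\lambda_1}\cdots x_k^{\lambda_k}\prod_{\lambda_i>\lambda_j}\frac{x_i-tx_j}{x_i-x_j}\bigg)\in\mathbb{Z}[t][x_1,\dots,x_k]$$ be the Hall--Littlewood polynomial, where $S_k^\lambda$ is the stabiliser of $\lambda$ in $S_k$, and let $P_\lambda(x_1,x_2,\dots;t)$ be the corresponding Hall--Littlewood symmetric function in countably many variables, in which the coefficient of each monomial is its coefficient in $P_\lambda(x_1,\dots,x_k;t)$ for all sufficiently large $k$. For an integer $b\geq 1$ let $(q^b;q^b)_m=\prod_{i=1}^{m}(1-q^{bi})$ if $m\geq 0$, and $1/(q^b;q^b)_m:=0$ if $m<0$. Let $(2^r)$ be the partition with $r$ parts, all equal to $2$. Then for all nonnegative integers $r,n$ and all $\delta\in\{0,1\}$, the following identity holds in the ring $\mathbb{Z}[[q]]$ of formal power series, where $r_0:=r$: $$P_{(2^r)}\big(1,q,q^2,\dots;q^{2n+\delta}\big)=\sum_{r_1,\dots,r_n\geq 0}\frac{q^{r^2-r+r_1^2+\dots+r_n^2+r_1+\dots+r_n}}{(q;q)_{r_0-r_1}(q;q)_{r_1-r_2}\cdots(q;q)_{r_{n-1}-r_n}\,(q^{2-\delta};q^{2-\delta})_{r_n}}.$$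 Here the left-hand side is the (convergent) sum of the power series obtained by substituting $x_i=q^{i-1}$ and $t=q^{2n+\delta}$ in the individual monomial terms of the symmetric function; only finitely many terms on the right are nonzero, and for $n=0$ the right-hand side is $q^{r^2-r}/(q^{2-\delta};q^{2-\delta})_r$. -/

import Mathlib

open scoped PowerSeries.WithPiTopology

namespace HallLittlewood

noncomputable section

/-- The ring `ℤ[t][x₁, …, x_k]`; the parameter `t` is `Polynomial.X`. -/
abbrev Poly (k : ℕ) : Type := MvPolynomial (Fin k) (Polynomial ℤ)

/-- The field of rational functions in `x₁, …, x_k` and `t`. -/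
abbrev RatFun (k : ℕ) : Type := FractionRing (Poly k)

/-- The variable `x_i` as a rational function. -/
def x {k : ℕ} (i : Fin k) : RatFun k := algebraMap (Poly k) (RatFun k) (MvPolynomial.X i)

/-- The parameter `t` as a rational function. -/
def t (k : ℕ) : RatFun k := algebraMap (Poly k) (RatFun k) (MvPolynomial.C Polynomial.X)

/-- The subgroup `S_k^λ` of all permutations in `S_k` that fix `λ = (λ₁, …, λ_k)`. -/
def stab {k : ℕ} (lam : Fin k → ℕ) : Subgroup (Equiv.Perm (Fin k)) where
  carrier := {w | ∀ i, lam (w i) = lam i}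
  mul_mem' {a b} ha hb i := by
    change lam (a (b i)) = lam i
    rw [ha, hb]
  one_mem' i := rfl
  inv_mem' {a} ha i := by
    have h := ha (a⁻¹ i)
    rw [← Equiv.Perm.mul_apply, mul_inv_cancel, Equiv.Perm.one_apply] at h
    exact h.symm

/-- The rational function
`w (x₁ ^ λ₁ ⋯ x_k ^ λ_k ∏_{λ_i > λ_j} (x_i - t x_j) / (x_i - x_j))`,
where the permutation `w` acts by `x_i ↦ x_{w(i)}`. -/
def term {k : ℕ} (lam : Fin k → ℕ) (w : Equiv.Perm (Fin k)) : RatFun k :=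
  (∏ i, x (w i) ^ lam i) *
    ∏ p : Fin k × Fin k with lam p.2 < lam p.1,
      (x (w p.1) - t k * x (w p.2)) / (x (w p.1) - x (w p.2))

theorem term_mul_of_mem_stab {k : ℕ} (lam : Fin k → ℕ) (w s : Equiv.Perm (Fin k))
    (hs : s ∈ stab lam) : term lam (w * s) = term lam w := by
  have hs' : ∀ i, lam (s i) = lam i := hs
  unfold term
  congr 1
  · refine Fintype.prod_equiv s _ _ fun i => ?_
    rw [hs', Equiv.Perm.mul_apply]
  · refine Finset.prod_equiv (Equiv.prodCongr s s) (fun p => ?_) (fun p _ => ?_)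
    · simp [hs']
    · simp [Equiv.Perm.mul_apply]

/-- The summand, as a function on the cosets `S_k / S_k^λ`. -/
def cosetTerm {k : ℕ} (lam : Fin k → ℕ) (c : Equiv.Perm (Fin k) ⧸ stab lam) : RatFun k :=
  Quotient.liftOn' c (term lam) fun a b hab => by
    have h := term_mul_of_mem_stab lam a (a⁻¹ * b) (QuotientGroup.leftRel_apply.mp hab)
    rw [mul_inv_cancel_left] at h
    exact h.symm

open Classical in
/-- The Hall–Littlewood polynomial `P_λ(x₁, …, x_k; t)`, as a rational function:
the sum of the `w`-images over `w ∈ S_k / S_k^λ`. -/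
def ratP {k : ℕ} (lam : Fin k → ℕ) : RatFun k :=
  ∑ c : Equiv.Perm (Fin k) ⧸ stab lam, cosetTerm lam c

/-! ### `ratP lam` is a polynomial -/

/-- The substitution `x_i ↦ x_j`. -/
def merge {k : ℕ} (i j : Fin k) : Poly k →ₐ[Polynomial ℤ] Poly k :=
  MvPolynomial.aeval (Function.update MvPolynomial.X i (MvPolynomial.X j))

theorem sub_dvd_iff {k : ℕ} (i j : Fin k) (p : Poly k) :
    (MvPolynomial.X i - MvPolynomial.X j : Poly k) ∣ p ↔ merge i j p = 0 := by
  constructor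
  · rintro ⟨a, rfl⟩
    by_cases h : j = i
    · subst h; simp
    · simp [merge, Function.update_of_ne h]
  · intro h
    rw [← Ideal.mem_span_singleton, ← Ideal.Quotient.eq_zero_iff_mem]
    set I : Ideal (Poly k) := Ideal.span {MvPolynomial.X i - MvPolynomial.X j} with hI
    have key : (Ideal.Quotient.mkₐ (Polynomial ℤ) I).comp (merge i j)
        = Ideal.Quotient.mkₐ (Polynomial ℤ) I := by
      refine MvPolynomial.algHom_ext fun l => ?_
      by_cases hl : l = i
      · subst hl
        simp only [merge, AlgHom.comp_apply, MvPolynomial.aeval_X, Function.update_self,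
          Ideal.Quotient.mkₐ_eq_mk]
        rw [eq_comm, Ideal.Quotient.eq]
        exact Ideal.mem_span_singleton_self _
      · simp [merge, Function.update_of_ne hl]
    have h2 := DFunLike.congr_fun key p
    simpa [h] using h2.symm

theorem sub_ne_zero {k : ℕ} {i j : Fin k} (hij : i ≠ j) :
    (MvPolynomial.X i - MvPolynomial.X j : Poly k) ≠ 0 :=
  fun h => hij (MvPolynomial.X_injective (sub_eq_zero.mp h))

theorem prime_sub {k : ℕ} {i j : Fin k} (hij : i ≠ j) :
    Prime (MvPolynomial.X i - MvPolynomial.X j : Poly k) := by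
  refine ⟨sub_ne_zero hij, fun h => ?_, fun a b h => ?_⟩
  · have := (sub_dvd_iff i j 1).mp h.dvd
    simp at this
  · rw [sub_dvd_iff, map_mul, mul_eq_zero] at h
    rwa [sub_dvd_iff, sub_dvd_iff]

theorem isRelPrime_sub {k : ℕ} {i j i' j' : Fin k} (hij : i ≠ j) (hij' : i' ≠ j')
    (h1 : ¬(i' = i ∧ j' = j)) (h2 : ¬(i' = j ∧ j' = i)) :
    IsRelPrime (MvPolynomial.X i - MvPolynomial.X j : Poly k)
      (MvPolynomial.X i' - MvPolynomial.X j') := by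
  rw [(prime_sub hij).irreducible.isRelPrime_iff_not_dvd, sub_dvd_iff]
  simp only [merge, map_sub, MvPolynomial.aeval_X, Function.update_apply]
  have inj := MvPolynomial.X_injective (σ := Fin k) (R := Polynomial ℤ)
  split_ifs with ha hb hb <;> rw [sub_eq_zero] <;> intro h <;> have h := inj h <;> grind

theorem prod_sub_dvd {k : ℕ} (s : Finset (Fin k × Fin k)) (hs : ∀ p ∈ s, p.1 ≠ p.2)
    (hs' : ∀ p ∈ s, p.swap ∉ s) (V : Poly k)
    (hV : ∀ p ∈ s, (MvPolynomial.X p.1 - MvPolynomial.X p.2 : Poly k) ∣ V) :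
    (∏ p ∈ s, (MvPolynomial.X p.1 - MvPolynomial.X p.2 : Poly k)) ∣ V := by
  refine Finset.prod_dvd_of_isRelPrime (fun p hp p' hp' hne => ?_) hV
  refine isRelPrime_sub (hs p hp) (hs p' hp') (fun h => hne ?_) (fun h => hs' p hp ?_)
  · exact Prod.ext h.1.symm h.2.symm
  · have : p.swap = p' := Prod.ext h.1.symm h.2.symm
    rwa [this]

/-- The Vandermonde product `∏_{i < j} (x_j - x_i)`. -/
def vdm (k : ℕ) : Poly k :=
  (Matrix.vandermonde (MvPolynomial.X : Fin k → Poly k)).det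

theorem vdm_eq (k : ℕ) :
    vdm k = ∏ p : Fin k × Fin k with p.2 < p.1,
      (MvPolynomial.X p.1 - MvPolynomial.X p.2 : Poly k) := by
  rw [vdm, Matrix.det_vandermonde, Finset.prod_sigma']
  refine Finset.prod_bij' (fun a _ => (a.2, a.1)) (fun p _ => ⟨p.2, p.1⟩) ?_ ?_ ?_ ?_ ?_ <;> simp

theorem vdm_ne_zero (k : ℕ) : vdm k ≠ 0 :=
  Matrix.det_vandermonde_ne_zero_iff.mpr MvPolynomial.X_injective

theorem rename_vdm {k : ℕ} (s : Equiv.Perm (Fin k)) :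
    MvPolynomial.rename s (vdm k) = ((Equiv.Perm.sign s : ℤ) : Poly k) * vdm k := by
  rw [vdm, ← Matrix.det_permute]
  change (MvPolynomial.rename s : Poly k →ₐ[Polynomial ℤ] Poly k).toRingHom _ = _
  rw [RingHom.map_det]
  congr 1
  ext1 a b
  simp [Matrix.vandermonde_apply, Matrix.submatrix_apply]

theorem merge_eq_zero_of_rename {k : ℕ} {i j : Fin k} (p : Poly k)
    (hp : MvPolynomial.rename (Equiv.swap i j) p = -p) : merge i j p = 0 := by
  have key : (merge i j).comp (MvPolynomial.rename (Equiv.swap i j)) = merge i j := by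
    refine MvPolynomial.algHom_ext fun l => ?_
    simp only [merge, AlgHom.comp_apply, MvPolynomial.rename_X, MvPolynomial.aeval_X,
      Function.update_apply, Equiv.swap_apply_def]
    split_ifs <;> simp_all
  have h := DFunLike.congr_fun key p
  rw [AlgHom.comp_apply, hp, map_neg] at h
  exact self_eq_neg.mp h.symm

theorem sub_dvd_vdm {k : ℕ} {i j : Fin k} (hij : i ≠ j) :
    (MvPolynomial.X i - MvPolynomial.X j : Poly k) ∣ vdm k := by
  rw [sub_dvd_iff]
  apply merge_eq_zero_of_rename
  rw [rename_vdm, Equiv.Perm.sign_swap hij]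
  simp only [Units.val_neg, Units.val_one, Int.cast_neg, Int.cast_one]
  ring

theorem exists_vdm_mul_term {k : ℕ} (lam : Fin k → ℕ) (w : Equiv.Perm (Fin k)) :
    ∃ g : Poly k, algebraMap (Poly k) (RatFun k) g = algebraMap (Poly k) (RatFun k) (vdm k) * term lam w := by
  set s : Finset (Fin k × Fin k) := Finset.univ.filter fun p => lam p.2 < lam p.1 with hs
  have hdvd : (∏ p ∈ s, (MvPolynomial.X (w p.1) - MvPolynomial.X (w p.2) : Poly k)) ∣ vdm k := by
    have h := prod_sub_dvd (s.map (Equiv.prodCongr w w).toEmbedding) ?_ ?_ (vdm k) ?_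
    · simpa [Finset.prod_map] using h
    · intro p hp
      obtain ⟨a, ha, rfl⟩ := Finset.mem_map.mp hp
      have ha : lam a.2 < lam a.1 := by simpa [hs] using ha
      intro h
      have : a.1 = a.2 := w.injective h
      rw [this] at ha
      exact lt_irrefl _ ha
    · intro p hp hp'
      obtain ⟨a, ha, rfl⟩ := Finset.mem_map.mp hp
      obtain ⟨b, hb, hab⟩ := Finset.mem_map.mp hp'
      have ha : lam a.2 < lam a.1 := by simpa [hs] using ha
      have hb : lam b.2 < lam b.1 := by simpa [hs] using hb
      have h1 : b.1 = a.2 := w.injective (congrArg Prod.fst hab)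
      have h2 : b.2 = a.1 := w.injective (congrArg Prod.snd hab)
      rw [h1, h2] at hb
      exact lt_asymm ha hb
    · intro p hp
      obtain ⟨a, ha, rfl⟩ := Finset.mem_map.mp hp
      have ha : lam a.2 < lam a.1 := by simpa [hs] using ha
      refine sub_dvd_vdm fun h => ?_
      have : a.1 = a.2 := w.injective h
      rw [this] at ha
      exact lt_irrefl _ ha
  obtain ⟨u, hu⟩ := hdvd
  refine ⟨(∏ i, MvPolynomial.X (w i) ^ lam i) *
    (∏ p ∈ s, (MvPolynomial.X (w p.1) - MvPolynomial.C Polynomial.X * MvPolynomial.X (w p.2))) * u,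
    ?_⟩
  have hne : (∏ p ∈ s, (x (w p.1) - x (w p.2) : RatFun k)) ≠ 0 := by
    refine Finset.prod_ne_zero_iff.mpr fun p hp h => ?_
    have hp : lam p.2 < lam p.1 := by simpa [hs] using hp
    have h := MvPolynomial.X_injective
      (IsFractionRing.injective (Poly k) (RatFun k) (_root_.sub_eq_zero.mp h))
    have : p.1 = p.2 := w.injective h
    rw [this] at hp
    exact lt_irrefl _ hp
  rw [hu, term, Finset.prod_div_distrib, ← hs]
  simp only [map_mul, map_prod, map_pow, map_sub]
  change (∏ i, x (w i) ^ lam i) * (∏ p ∈ s, (x (w p.1) - t k * x (w p.2))) * _ =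
    (∏ p ∈ s, (x (w p.1) - x (w p.2) : RatFun k)) * _ * _
  field_simp

/-- The automorphism `x_i ↦ x_{s(i)}` of the field of rational functions. -/
def permRat {k : ℕ} (s : Equiv.Perm (Fin k)) : RatFun k ≃+* RatFun k :=
  IsFractionRing.ringEquivOfRingEquiv (MvPolynomial.renameEquiv (Polynomial ℤ) s).toRingEquiv

theorem permRat_algebraMap {k : ℕ} (s : Equiv.Perm (Fin k)) (p : Poly k) :
    permRat s (algebraMap (Poly k) (RatFun k) p) =
      algebraMap (Poly k) (RatFun k) (MvPolynomial.rename s p) := by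
  rw [permRat, IsFractionRing.ringEquivOfRingEquiv_algebraMap]
  rfl

theorem permRat_term {k : ℕ} (lam : Fin k → ℕ) (s w : Equiv.Perm (Fin k)) :
    permRat s (term lam w) = term lam (s * w) := by
  simp [term, x, t, permRat_algebraMap]

theorem permRat_ratP {k : ℕ} (lam : Fin k → ℕ) (s : Equiv.Perm (Fin k)) :
    permRat s (ratP lam) = ratP lam := by
  classical
  rw [ratP, map_sum]
  refine Fintype.sum_equiv (MulAction.toPerm s) _ _ fun c => ?_
  induction c using Quotient.inductionOn' with
  | h w => exact permRat_term lam s w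

theorem exists_poly {k : ℕ} (lam : Fin k → ℕ) :
    ∃ P : Poly k, algebraMap (Poly k) (RatFun k) P = ratP lam := by
  classical
  have h1 : ∀ c : Equiv.Perm (Fin k) ⧸ stab lam, ∃ g : Poly k,
      algebraMap (Poly k) (RatFun k) g = algebraMap (Poly k) (RatFun k) (vdm k) * cosetTerm lam c := by
    intro c
    induction c using Quotient.inductionOn' with
    | h w => exact exists_vdm_mul_term lam w
  choose g hg using h1
  have hG : algebraMap (Poly k) (RatFun k) (∑ c, g c) =
      algebraMap (Poly k) (RatFun k) (vdm k) * ratP lam := by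
    rw [map_sum, ratP, Finset.mul_sum]
    exact Finset.sum_congr rfl fun c _ => hg c
  have hdvd : vdm k ∣ ∑ c, g c := by
    conv_lhs => rw [vdm_eq]
    refine prod_sub_dvd _ (fun p hp => ?_) (fun p hp hp' => ?_) _ (fun p hp => ?_)
    · exact (by simpa using hp : p.2 < p.1).ne'
    · exact lt_asymm (by simpa using hp : p.2 < p.1) (by simpa using hp')
    · have hne : p.1 ≠ p.2 := (by simpa using hp : p.2 < p.1).ne'
      rw [sub_dvd_iff]
      apply merge_eq_zero_of_rename
      apply IsFractionRing.injective (Poly k) (RatFun k)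
      rw [← permRat_algebraMap, hG, map_mul, permRat_ratP, permRat_algebraMap, rename_vdm,
        Equiv.Perm.sign_swap hne, map_neg, hG]
      simp
  obtain ⟨P, hP⟩ := hdvd
  refine ⟨P, ?_⟩
  rw [hP, map_mul] at hG
  refine mul_left_cancel₀ ?_ hG
  rw [Ne, IsFractionRing.to_map_eq_zero_iff]
  exact vdm_ne_zero k

/-! ### Hall–Littlewood polynomials and functions -/

/-- The Hall–Littlewood polynomial `P_λ(x₁, …, x_k; t) ∈ ℤ[t][x₁, …, x_k]`, that is, the unique
polynomial that is equal to the rational function `ratP lam`. -/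
def polyP {k : ℕ} (lam : Fin k → ℕ) : Poly k := (exists_poly lam).choose

theorem algebraMap_polyP {k : ℕ} (lam : Fin k → ℕ) :
    algebraMap (Poly k) (RatFun k) (polyP lam) = ratP lam := (exists_poly lam).choose_spec

/-- The Hall–Littlewood symmetric function `P_λ(x₁, x₂, …; t)` in countably many variables, as a
formal power series over `ℤ[t]` (the variable `x_{i+1}` has index `i`). By stability the
coefficient of a monomial is its coefficient in `P_λ(x₁, …, x_k; t)` for any `k ≥ l(λ)` such that
only `x₁, …, x_k` occur in the monomial; the least such `k` is taken.
Here `lam.rowLen i` is `λ_{i+1}` and `lam.colLen 0` is the length `l(λ)`. -/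
def symP (lam : YoungDiagram) : MvPowerSeries ℕ (Polynomial ℤ) := fun m =>
  MvPolynomial.coeff
    (m.comapDomain Fin.val Fin.val_injective.injOn)
    (polyP fun i : Fin (max (lam.colLen 0) (m.support.sup (· + 1))) => lam.rowLen i)

/-- The statement `f(1, q, q², …; T) = s` in `ℤ⟦q⟧`, for a formal power series `f` in countably
many variables over `ℤ[t]`: substituting `x_{i+1} = q ^ i` and `t = T` in all terms of `f` gives a
summable family with sum `s`. (`ℤ⟦q⟧` has the topology of coefficientwise convergence, with `ℤ`
discrete.) -/
def HasPrincipalSpecialization (f : MvPowerSeries ℕ (Polynomial ℤ)) (T s : PowerSeries ℤ) : Prop :=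
  HasSum (fun m : ℕ →₀ ℕ =>
    Polynomial.aeval T (MvPowerSeries.coeff m f) *
      m.prod fun i e => ((PowerSeries.X : PowerSeries ℤ) ^ i) ^ e) s

/-- The partition `(2^r)`, with `r` parts equal to `2`. -/
def twoPow (r : ℕ) : YoungDiagram :=
  YoungDiagram.ofRowLens (List.replicate r 2) (List.pairwise_replicate_of_refl.sortedGE)

/-- The `q`-shifted factorial `(a; q)_m = ∏_{i < m} (1 - a q ^ i)`. -/
def qPoch (a q : PowerSeries ℤ) (m : ℕ) : PowerSeries ℤ := ∏ i ∈ Finset.range m, (1 - a * q ^ i)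

/-- For `b ≥ 1` the series `(q^b; q^b)_m` is invertible in `ℤ⟦q⟧`. -/
theorem isUnit_qPoch {b : ℕ} (hb : 0 < b) (m : ℕ) :
    IsUnit (qPoch (PowerSeries.X ^ b) (PowerSeries.X ^ b) m) := by
  rw [PowerSeries.isUnit_iff_constantCoeff, qPoch, map_prod]
  simp [hb.ne']

/-- `1 / (q^b; q^b)_m` in `ℤ⟦q⟧` for `b ≥ 1` and an integer `m`, which is `0` for `m < 0`. -/
def invQPoch (b : ℕ) (m : ℤ) : PowerSeries ℤ :=
  if 0 ≤ m then Ring.inverse (qPoch (PowerSeries.X ^ b) (PowerSeries.X ^ b) m.toNat) else 0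

/-- The summand of the multisum at `(r₁, …, r_n)`, with `r₀ = r`:
`q^(r² - r + r₁² + ⋯ + r_n² + r₁ + ⋯ + r_n)` divided by
`(q; q)_{r₀ - r₁} ⋯ (q; q)_{r_{n-1} - r_n} (q^b; q^b)_{r_n}`. -/
def summand (r n b : ℕ) (ρ : Fin n → ℕ) : PowerSeries ℤ :=
  let c : Fin (n + 1) → ℕ := Fin.cons r ρ
  PowerSeries.X ^ (r ^ 2 - r + ∑ i, (ρ i ^ 2 + ρ i)) *
    (∏ i : Fin n, invQPoch 1 ((c i.castSucc : ℤ) - (c i.succ : ℤ))) * invQPoch b (c (Fin.last n))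

/-- Only finitely many summands are nonzero. -/
theorem finite_support_summand (r n b : ℕ) : (Function.support (summand r n b)).Finite := by
  refine (Set.Finite.pi' fun _ : Fin n => Set.finite_Iic r).subset fun ρ hρ i => ?_
  by_contra hi
  apply hρ
  set c : Fin (n + 1) → ℕ := Fin.cons r ρ with hc
  have hex : ∃ i : Fin n, c i.castSucc < c i.succ := by
    by_contra! h
    have hanti : Antitone c := Fin.antitone_iff_succ_le.mpr h
    have h0 := hanti (Fin.zero_le i.succ)
    simp only [hc, Fin.cons_succ, Fin.cons_zero] at h0
    exact hi h0
  obtain ⟨l, hl⟩ := hex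
  have hz : ∏ i : Fin n, invQPoch 1 ((c i.castSucc : ℤ) - (c i.succ : ℤ)) = 0 := by
    refine Finset.prod_eq_zero (Finset.mem_univ l) ?_
    rw [invQPoch, if_neg]
    omega
  simp only [summand, ← hc, hz, mul_zero, zero_mul]

end

end HallLittlewood

/-!
The polynomial `P_{(2^r)}(x₁, …, x_k; t)` is a sum over the `r`-subsets of the variables. Splitting
off one variable gives a recursion in `r`, and by Lagrange interpolation the alternating sum
`∑_j (-1)^j t^(j(j+1)/2) s_{(2^{r-j} 1^{2j})}` of Schur polynomials satisfies the same recursion, so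
that it equals `P_{(2^r)}`. The dual Jacobi–Trudi formula reduces these Schur polynomials to
elementary symmetric ones, and `e_a(1, q, q², …) = q^(a(a-1)/2) / (q; q)_a`. At `t = q^N` the result
is `q^(r² - r) β_r` for a Bailey pair `(α, β)` in which `N` enters `α_k` only through the factor
`q^(N k(k+1)/2)`, so that `N ↦ N + 2` is one application of the Bailey lemma and accounts for one of
the summations. For `N = 1` this leads back to the unit Bailey pair; for `N = 0` the sum telescopes.
-/

namespace HallLittlewood

open Finset.HasAntidiagonal (antidiagonal mem_antidiagonal)

section ElementarySymmetric

variable {ι R : Type*}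

theorem esymm_cons [CommSemiring R] (a : R) (s : Multiset R) (b : ℕ) :
    (a ::ₘ s).esymm (b + 1) = s.esymm (b + 1) + a * s.esymm b := by
  simp [Multiset.esymm, Multiset.powersetCard_cons, Multiset.sum_map_mul_left]

theorem esymm_eq_esymm_erase_add [CommSemiring R] [DecidableEq ι] (x : ι → R) {s : Finset ι}
    {i : ι} (hi : i ∈ s) (b : ℕ) :
    (s.val.map x).esymm (b + 1) =
      ((s.erase i).val.map x).esymm (b + 1) + x i * ((s.erase i).val.map x).esymm b := by
  rw [← esymm_cons, ← Multiset.map_cons, Finset.erase_val, Multiset.cons_erase hi]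

theorem esymm_zero [CommSemiring R] (s : Multiset R) : s.esymm 0 = 1 := by
  simp [Multiset.esymm]

theorem esymm_card [CommSemiring R] (s : Multiset R) : s.esymm (Multiset.card s) = s.prod := by
  simp [Multiset.esymm, Multiset.powersetCard_self]

theorem esymm_eq_zero_of_card_lt [CommSemiring R] {s : Multiset R} {b : ℕ}
    (h : Multiset.card s < b) : s.esymm b = 0 := by
  simp [Multiset.esymm, Multiset.powersetCard_eq_empty b h]

theorem esymm_map_eq_of_subset [CommSemiring R] {x : ι → R} {s s' : Finset ι}
    (h : s ⊆ s') (h0 : ∀ i ∈ s', i ∉ s → x i = 0) (a : ℕ) :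
    (s'.val.map x).esymm a = (s.val.map x).esymm a := by
  rw [Finset.esymm_map_val, Finset.esymm_map_val]
  refine (Finset.sum_subset (Finset.powersetCard_mono h) fun A hA hAs => ?_).symm
  obtain ⟨hAs', hcard⟩ := Finset.mem_powersetCard.mp hA
  obtain ⟨i, hi, his⟩ := Finset.not_subset.mp fun hsub =>
    hAs (Finset.mem_powersetCard.mpr ⟨hsub, hcard⟩)
  exact Finset.prod_eq_zero hi (h0 i (hAs' hi) his)

theorem map_esymm {S : Type*} [CommSemiring R] [CommSemiring S] (f : R →+* S) (s : Multiset R)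
    (b : ℕ) : f (s.esymm b) = (s.map f).esymm b := by
  simp [Multiset.esymm, Multiset.powersetCard_map, map_multiset_sum, map_multiset_prod]

theorem coeff_prod_X_add_C [CommSemiring R] {x : ι → R} {s : Finset ι} {a b : ℕ}
    (h : a + b = s.card) :
    (∏ i ∈ s, (Polynomial.X + Polynomial.C (x i))).coeff a = (s.val.map x).esymm b := by
  rw [Finset.prod_X_add_C_coeff s x (by omega), Finset.esymm_map_val, ← h, Nat.add_sub_cancel_left]

end ElementarySymmetric

section Antidiagonal

theorem sum_antidiagonal_telescope {M : Type*} [AddCommGroup M] {F G : ℕ → ℕ → M}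
    (h : ∀ a j, G (a + 1) j = F a (j + 1)) (r : ℕ) :
    ∑ p ∈ antidiagonal r, (F p.1 p.2 - G p.1 p.2) = F r 0 - G 0 r := by
  cases r with
  | zero => simp
  | succ r =>
    rw [Finset.sum_sub_distrib, Finset.Nat.sum_antidiagonal_succ', Finset.Nat.sum_antidiagonal_succ]
    simp only [h, add_sub_add_right_eq_sub]

theorem sum_antidiagonal_assoc {A M : Type*} [AddMonoid A] [Finset.HasAntidiagonal A]
    [AddCommMonoid M] (f : A → A → A → M) (n : A) :
    ∑ p ∈ antidiagonal n, ∑ u ∈ antidiagonal p.2, f p.1 u.1 u.2 =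
      ∑ p ∈ antidiagonal n, ∑ u ∈ antidiagonal p.1, f u.1 u.2 p.2 := by
  rw [Finset.sum_sigma', Finset.sum_sigma']
  refine Finset.sum_bij' (fun v _ => ⟨(v.1.1 + v.2.1, v.2.2), (v.1.1, v.2.1)⟩)
    (fun v _ => ⟨(v.2.1, v.2.2 + v.1.2), (v.2.2, v.1.2)⟩) ?_ ?_ ?_ ?_ fun _ _ => rfl
  all_goals
    rintro ⟨⟨i, j⟩, u⟩ h
    simp only [Finset.mem_sigma, mem_antidiagonal] at h ⊢
    obtain ⟨rfl, rfl⟩ := h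
    simp [add_assoc]

end Antidiagonal

section TriangularNumbers

theorem choose_succ_two (j : ℕ) : (j + 1).choose 2 = j.choose 2 + j := by
  rw [Nat.choose_succ_succ, Nat.choose_one_right, add_comm]

theorem two_mul_choose_two (j : ℕ) : 2 * j.choose 2 = j ^ 2 - j := by
  rw [Nat.choose_two_right, Nat.mul_div_cancel' (Nat.even_mul_pred_self j).two_dvd,
    Nat.mul_sub_one, sq]

theorem choose_two_add_choose_two (a j : ℕ) :
    a.choose 2 + (a + 2 * j).choose 2 = (a + j) ^ 2 - (a + j) + j ^ 2 := by
  rw [← two_mul_choose_two]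
  induction j with
  | zero => simp [two_mul]
  | succ j ih =>
    rw [mul_add_one, ← add_assoc, ← add_assoc, choose_succ_two (a + 2 * j + 1), choose_succ_two,
      choose_succ_two]
    linarith

end TriangularNumbers

section TwoColumns

variable {R : Type*} [CommRing R]

/-- The two-column dual Jacobi–Trudi determinant `e_a e_b - e_{a-1} e_{b+1}`: for `a ≤ b` and the
elementary symmetric polynomials `e`, the Schur polynomial whose columns have lengths `b` and `a`.
The term `e_{-1} e_{b+1}` of the case `a = 0` is read as zero. -/
def twoColSchur (e : ℕ → R) : ℕ → ℕ → R
  | 0, b => e 0 * e b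
  | a + 1, b => e (a + 1) * e b - e a * e (b + 1)

/-- The alternating sum `∑_{a + j = r} (-1)^j t^(j(j+1)/2) s_{(2^a 1^{2j})}` of two-column Schur
polynomials, which turns out to be the Schur expansion of `P_{(2^r)}`. -/
def twoColSum (e : ℕ → R) (t : R) (r : ℕ) : R :=
  ∑ p ∈ antidiagonal r, (-1) ^ p.2 * t ^ (p.2 + 1).choose 2 * twoColSchur e p.1 (p.1 + 2 * p.2)

theorem map_twoColSchur {S : Type*} [CommRing S] (f : R →+* S) (e : ℕ → R) (a b : ℕ) :
    f (twoColSchur e a b) = twoColSchur (fun i => f (e i)) a b := by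
  cases a <;> simp [twoColSchur]

theorem map_twoColSum {S : Type*} [CommRing S] (f : R →+* S) (e : ℕ → R) (t : R) (r : ℕ) :
    f (twoColSum e t r) = twoColSum (fun i => f (e i)) (f t) r := by
  simp [twoColSum, map_twoColSchur]

theorem dvd_twoColSum_sub_twoColSum {c : R} {e e' : ℕ → R} (h : ∀ i, c ∣ e i - e' i) (t : R)
    (r : ℕ) : c ∣ twoColSum e t r - twoColSum e' t r := by
  simp only [← Ideal.mem_span_singleton, ← Ideal.Quotient.eq] at h ⊢
  rw [map_twoColSum, map_twoColSum, funext h]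

theorem twoColSum_succ (e : ℕ → R) (t : R) (r : ℕ) :
    twoColSum e t (r + 1) =
      (-1) ^ (r + 1) * t ^ (r + 2).choose 2 * (e 0 * e (2 * (r + 1))) +
        ∑ p ∈ antidiagonal r, (-1) ^ p.2 * t ^ (p.2 + 1).choose 2 *
          (e (p.1 + 1) * e (p.1 + 2 * p.2 + 1) - e p.1 * e (p.1 + 2 * p.2 + 2)) := by
  rw [twoColSum, Finset.Nat.sum_antidiagonal_succ]
  refine congrArg₂ _ (by simp [twoColSchur]) (Finset.sum_congr rfl fun p _ => ?_)
  rw [twoColSchur, show p.1 + 1 + 2 * p.2 = p.1 + 2 * p.2 + 1 by ring]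

theorem one_sub_pow_mul_twoColSum_succ (e : ℕ → R) (t : R) (r : ℕ) :
    (1 - t ^ (r + 1)) * twoColSum e t (r + 1) =
      ∑ p ∈ antidiagonal r, (-1) ^ p.2 * t ^ (p.2 + 1).choose 2 *
        ((1 - t ^ (p.1 + 1)) * (e (p.1 + 1) * e (p.1 + 2 * p.2 + 1)) -
          (1 - t ^ (p.1 + 2 * p.2 + 2)) * (e p.1 * e (p.1 + 2 * p.2 + 2))) := by
  let F (a j : ℕ) : R := (-1) ^ j * t ^ (j + 1).choose 2 * (t ^ (a + 1) - t ^ (r + 1)) *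
    (e (a + 1) * e (a + 2 * j + 1))
  let G (a j : ℕ) : R := (-1) ^ (j + 1) * t ^ (j + 2).choose 2 * (t ^ a - t ^ (r + 1)) *
    (e a * e (a + 2 * j + 2))
  have hFG (a j : ℕ) : G (a + 1) j = F a (j + 1) := by
    simp only [F, G, show a + 1 + 2 * j + 2 = a + 2 * (j + 1) + 1 by ring]
  have htelescope := sum_antidiagonal_telescope hFG r
  have hterm : ∀ p ∈ antidiagonal r, (-1) ^ p.2 * t ^ (p.2 + 1).choose 2 *
      ((1 - t ^ (p.1 + 1)) * (e (p.1 + 1) * e (p.1 + 2 * p.2 + 1)) -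
        (1 - t ^ (p.1 + 2 * p.2 + 2)) * (e p.1 * e (p.1 + 2 * p.2 + 2))) =
      (1 - t ^ (r + 1)) * ((-1) ^ p.2 * t ^ (p.2 + 1).choose 2 *
        (e (p.1 + 1) * e (p.1 + 2 * p.2 + 1) - e p.1 * e (p.1 + 2 * p.2 + 2))) -
      (F p.1 p.2 - G p.1 p.2) := by
    intro p hp
    obtain rfl := mem_antidiagonal.mp hp
    simp only [F, G, choose_succ_two (p.2 + 1)]
    ring
  have hF : F r 0 = 0 := by simp [F]
  have hG : G 0 r = (1 - t ^ (r + 1)) *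
      ((-1) ^ (r + 1) * t ^ (r + 2).choose 2 * (e 0 * e (2 * (r + 1)))) := by
    simp only [G, show 0 + 2 * r + 2 = 2 * (r + 1) by ring]
    ring
  rw [Finset.sum_congr rfl hterm, Finset.sum_sub_distrib, htelescope, hF, hG, twoColSum_succ,
    mul_add, Finset.mul_sum, zero_sub, sub_neg_eq_add, add_comm]

end TwoColumns

section Weights

open Polynomial in
theorem degree_prod_X_add_C_sub_lt {ι K : Type*} [Field K] (s : Finset ι) (x y : ι → K) :
    (∏ j ∈ s, (X + C (x j)) - ∏ j ∈ s, (X + C (y j))).degree < (s.card : WithBot ℕ) := by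
  have hdegree (z : ι → K) : (∏ j ∈ s, (X + C (z j))).degree = (s.card : WithBot ℕ) := by
    simp [degree_prod]
  have hmonic (z : ι → K) : (∏ j ∈ s, (X + C (z j))).Monic :=
    monic_prod_of_monic _ _ fun j _ => monic_X_add_C (z j)
  rw [← hdegree x]
  refine degree_sub_lt_left ?_ (hmonic x).ne_zero ?_
  · rw [hdegree, hdegree]
  · rw [(hmonic x).leadingCoeff, (hmonic y).leadingCoeff]

variable {ι K : Type*} [DecidableEq ι] [Field K] {x : ι → K} {s : Finset ι}

/-- The product `∏_{j ∈ s, j ≠ i} (x_i - t x_j) / (x_i - x_j)`, the weight with which the variable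
`x_i` is split off in the recursion for Hall–Littlewood polynomials. -/
def hlWeight (x : ι → K) (t : K) (s : Finset ι) (i : ι) : K :=
  ∏ j ∈ s.erase i, (x i - t * x j) / (x i - x j)

open Polynomial in
/-- Lagrange interpolation of the right-hand side at the nodes `-x_i`, where the first product
vanishes. -/
theorem sum_hlWeight_mul_prod (t : K) (hx : Set.InjOn x s) :
    ∑ i ∈ s, C ((1 - t) * (x i * hlWeight x t s i)) * ∏ j ∈ s.erase i, (X + C (x j)) =
      ∏ j ∈ s, (X + C (x j)) - ∏ j ∈ s, (X + C (t * x j)) := by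
  have hinj : Set.InjOn (fun i => -x i) s := fun a ha b hb h => hx ha hb (neg_injective h)
  have heval (i : ι) (hi : i ∈ s) :
      (∏ j ∈ s, (X + C (x j)) - ∏ j ∈ s, (X + C (t * x j))).eval (-x i) =
        (1 - t) * (x i * ∏ j ∈ s.erase i, (t * x j - x i)) := by
    simp only [eval_sub, eval_prod, eval_add, eval_X, eval_C]
    rw [Finset.prod_eq_zero hi (neg_add_cancel _), ← Finset.mul_prod_erase s _ hi]
    simp only [neg_add_eq_sub]
    ring
  rw [Lagrange.eq_interpolate_of_eval_eq _ hinj (degree_prod_X_add_C_sub_lt s x _) heval,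
    Lagrange.interpolate_apply]
  refine Finset.sum_congr rfl fun i _ => ?_
  have hweight : hlWeight x t s i =
      (∏ j ∈ s.erase i, (t * x j - x i)) * ∏ j ∈ s.erase i, (-x i - -x j)⁻¹ := by
    rw [hlWeight, ← Finset.prod_mul_distrib]
    refine Finset.prod_congr rfl fun j _ => ?_
    rw [div_eq_mul_inv, ← neg_sub (t * x j), neg_mul_comm, neg_inv]
    ring_nf
  simp only [Lagrange.basis, Lagrange.basisDivisor, Finset.prod_mul_distrib, ← map_prod,
    ← mul_assoc, ← map_mul, hweight, map_neg, sub_neg_eq_add]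

theorem sum_hlWeight_mul_esymm (t : K) (hx : Set.InjOn x s) (b : ℕ) :
    (1 - t) * ∑ i ∈ s, x i * hlWeight x t s i * ((s.erase i).val.map x).esymm b =
      (1 - t ^ (b + 1)) * (s.val.map x).esymm (b + 1) := by
  by_cases hb : b + 1 ≤ s.card
  · obtain ⟨a, ha⟩ := Nat.exists_eq_add_of_le' hb
    have hcoeff := congrArg (Polynomial.coeff · a) (sum_hlWeight_mul_prod t hx)
    have hscale := Multiset.pow_smul_esymm t (b + 1) (s.val.map x)
    rw [Multiset.map_map] at hscale
    simp only [Polynomial.finsetSum_coeff, Polynomial.coeff_sub, Polynomial.coeff_C_mul,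
      coeff_prod_X_add_C ha.symm] at hcoeff
    rw [one_sub_mul (t ^ (b + 1)), ← smul_eq_mul (t ^ (b + 1)), hscale]
    refine Eq.trans ?_ hcoeff
    rw [Finset.mul_sum]
    refine Finset.sum_congr rfl fun i hi => ?_
    have hcard : a + b = (s.erase i).card := by rw [Finset.card_erase_of_mem hi]; omega
    rw [coeff_prod_X_add_C hcard, mul_assoc]
    ring
  · have hzero (i : ι) (hi : i ∈ s) : ((s.erase i).val.map x).esymm b = 0 := by
      refine esymm_eq_zero_of_card_lt ?_
      have := Finset.card_erase_lt_of_mem hi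
      rw [Multiset.card_map, Finset.card_val]
      omega
    rw [esymm_eq_zero_of_card_lt (by simpa using hb), mul_zero, Finset.sum_eq_zero, mul_zero]
    intro i hi
    rw [hzero i hi, mul_zero]

theorem sum_hlWeight (t : K) (hx : Set.InjOn x s) (h0 : ∀ i ∈ s, x i ≠ 0) :
    (1 - t) * ∑ i ∈ s, hlWeight x t s i = 1 - t ^ s.card := by
  rcases s.eq_empty_or_nonempty with rfl | hs
  · simp
  obtain ⟨b, hb⟩ := Nat.exists_eq_add_of_le' (Finset.card_pos.mpr hs)
  have htop (u : Finset ι) : (u.val.map x).esymm u.card = ∏ i ∈ u, x i := by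
    simpa using esymm_card (u.val.map x)
  have hterm (i : ι) (hi : i ∈ s) : x i * hlWeight x t s i * ((s.erase i).val.map x).esymm b =
      hlWeight x t s i * ∏ i ∈ s, x i := by
    have hcard : b = (s.erase i).card := by rw [Finset.card_erase_of_mem hi]; omega
    rw [hcard, htop, ← Finset.mul_prod_erase s x hi]
    ring
  have h := sum_hlWeight_mul_esymm t hx b
  rw [Finset.sum_congr rfl hterm, ← Finset.sum_mul, ← mul_assoc, ← hb, htop] at h
  exact mul_right_cancel₀ (Finset.prod_ne_zero_iff.mpr h0) h

end Weights

section Rectangles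

theorem sum_powersetCard_succ_sum_erase {ι M : Type*} [DecidableEq ι] [AddCommMonoid M]
    (f : ι → Finset ι → M) (s : Finset ι) (r : ℕ) :
    ∑ I ∈ s.powersetCard (r + 1), ∑ i ∈ I, f i (I.erase i) =
      ∑ i ∈ s, ∑ J ∈ (s.erase i).powersetCard r, f i J := by
  rw [Finset.sum_sigma', Finset.sum_sigma']
  refine Finset.sum_bij' (fun a _ => ⟨a.2, a.1.erase a.2⟩) (fun a _ => ⟨insert a.1 a.2, a.1⟩)
    ?_ ?_ ?_ ?_ fun _ _ => rfl
  all_goals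
    rintro ⟨_, _⟩ h
    simp only [Finset.mem_sigma, Finset.mem_powersetCard, Finset.subset_erase] at h
  · obtain ⟨⟨hIs, hcard⟩, hi⟩ := h
    simp [Finset.erase_subset_erase _ hIs, hIs hi, Finset.card_erase_of_mem hi, hcard]
  · obtain ⟨hi, ⟨hJs, hiJ⟩, hcard⟩ := h
    simp [Finset.insert_subset hi hJs, Finset.card_insert_of_notMem hiJ, hcard]
  · simp [Finset.insert_erase h.2]
  · simp [Finset.erase_insert h.2.1.2]

variable {ι K : Type*} [DecidableEq ι] [Field K]

/-- The summand of `rectSum` for the set `I` of the variables that carry the exponent `c`. -/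
def rectTerm (x : ι → K) (t : K) (c : ℕ) (s I : Finset ι) : K :=
  ∏ i ∈ I, x i ^ c * ∏ j ∈ s \ I, (x i - t * x j) / (x i - x j)

/-- The Hall–Littlewood polynomial of the rectangle `(c^r)`, `c ≠ 0`, in the variables `x i`,
`i ∈ s`: a coset of the stabilizer is given by the set of the `r` variables of exponent `c`. -/
def rectSum (x : ι → K) (t : K) (c : ℕ) (s : Finset ι) (r : ℕ) : K :=
  ∑ I ∈ s.powersetCard r, rectTerm x t c s I

variable {x : ι → K} {s : Finset ι}

theorem hlWeight_mul_rectTerm (x : ι → K) (t : K) (c : ℕ) {I : Finset ι} (hI : I ⊆ s) {i : ι}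
    (hi : i ∈ I) :
    hlWeight x t I i * rectTerm x t c s I =
      x i ^ c * hlWeight x t s i * rectTerm x t c (s.erase i) (I.erase i) := by
  have hsdiff : s.erase i \ I.erase i = s \ I := by grind
  have hweight : hlWeight x t s i =
      (∏ j ∈ s \ I, (x i - t * x j) / (x i - x j)) * hlWeight x t I i := by
    rw [hlWeight, ← Finset.prod_sdiff (Finset.erase_subset_erase i hI), hsdiff, hlWeight]
  rw [rectTerm, rectTerm, hsdiff, hweight, ← Finset.mul_prod_erase I _ hi]
  ring

theorem one_sub_pow_mul_rectSum_succ (t : K) (c : ℕ) (hx : Set.InjOn x s)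
    (h0 : ∀ i ∈ s, x i ≠ 0) (r : ℕ) :
    (1 - t ^ (r + 1)) * rectSum x t c s (r + 1) =
      (1 - t) * ∑ i ∈ s, x i ^ c * hlWeight x t s i * rectSum x t c (s.erase i) r := by
  simp only [rectSum, Finset.mul_sum]
  rw [← sum_powersetCard_succ_sum_erase]
  refine Finset.sum_congr rfl fun I hI => ?_
  obtain ⟨hIs, hcard⟩ := Finset.mem_powersetCard.mp hI
  rw [← hcard, ← sum_hlWeight t (hx.mono hIs) fun i hi => h0 i (hIs hi), mul_assoc, Finset.sum_mul,
    Finset.mul_sum]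
  exact Finset.sum_congr rfl fun i hi => by rw [hlWeight_mul_rectTerm x t c hIs hi]

theorem sq_mul_twoColSchur_erase (x : ι → K) {i : ι} (hi : i ∈ s) (a b : ℕ) :
    x i ^ 2 * twoColSchur ((s.erase i).val.map x).esymm a b =
      x i * ((s.erase i).val.map x).esymm a * (s.val.map x).esymm (b + 1) -
        (s.val.map x).esymm a * (x i * ((s.erase i).val.map x).esymm (b + 1)) := by
  rw [esymm_eq_esymm_erase_add x hi b]
  cases a with
  | zero =>
    rw [twoColSchur, esymm_zero, esymm_zero]
    ring
  | succ a =>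
    rw [twoColSchur, esymm_eq_esymm_erase_add x hi a]
    ring

theorem sum_sq_mul_hlWeight_mul_twoColSchur (t : K) (hx : Set.InjOn x s) (a b : ℕ) :
    (1 - t) * ∑ i ∈ s, x i ^ 2 * hlWeight x t s i *
        twoColSchur ((s.erase i).val.map x).esymm a b =
      (1 - t ^ (a + 1)) * ((s.val.map x).esymm (a + 1) * (s.val.map x).esymm (b + 1)) -
        (1 - t ^ (b + 2)) * ((s.val.map x).esymm a * (s.val.map x).esymm (b + 2)) := by
  rw [← mul_assoc, ← sum_hlWeight_mul_esymm t hx, mul_left_comm _ ((s.val.map x).esymm a),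
    ← sum_hlWeight_mul_esymm t hx, mul_left_comm _ (1 - t), mul_assoc, ← mul_sub, Finset.sum_mul,
    Finset.mul_sum _ _ ((s.val.map x).esymm a), ← Finset.sum_sub_distrib]
  refine congrArg _ (Finset.sum_congr rfl fun i hi => ?_)
  rw [mul_right_comm, sq_mul_twoColSchur_erase x hi]
  ring

theorem one_sub_pow_mul_twoColSum_esymm_succ (t : K) (hx : Set.InjOn x s) (r : ℕ) :
    (1 - t ^ (r + 1)) * twoColSum (s.val.map x).esymm t (r + 1) =
      (1 - t) * ∑ i ∈ s, x i ^ 2 * hlWeight x t s i *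
        twoColSum ((s.erase i).val.map x).esymm t r := by
  rw [one_sub_pow_mul_twoColSum_succ]
  simp only [twoColSum, Finset.mul_sum]
  rw [Finset.sum_comm]
  refine Finset.sum_congr rfl fun p _ => ?_
  rw [← sum_sq_mul_hlWeight_mul_twoColSchur t hx, Finset.mul_sum, Finset.mul_sum]
  exact Finset.sum_congr rfl fun i _ => by ring

theorem rectSum_two_eq_twoColSum {t : K} (ht : ∀ m : ℕ, t ^ (m + 1) ≠ 1) (hx : Set.InjOn x s)
    (h0 : ∀ i ∈ s, x i ≠ 0) (r : ℕ) :
    rectSum x t 2 s r = twoColSum (s.val.map x).esymm t r := by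
  induction r generalizing s with
  | zero => simp [rectSum, rectTerm, twoColSum, twoColSchur, esymm_zero]
  | succ r ih =>
    refine mul_left_cancel₀ (sub_ne_zero_of_ne (ht r).symm) ?_
    rw [one_sub_pow_mul_rectSum_succ t 2 hx h0, one_sub_pow_mul_twoColSum_esymm_succ t hx]
    refine congrArg _ (Finset.sum_congr rfl fun i _ => ?_)
    rw [ih (hx.mono (Finset.erase_subset i s)) fun j hj => h0 j (Finset.mem_of_mem_erase hj)]

end Rectangles

section Bailey

variable {R : Type*} [CommRing R]

/-- The sequence `ψ` of the inverses `1 / (q; q)_m` of the `q`-factorials, characterised by its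
recurrence, so that `R` need not be a field. -/
structure IsInvQPoch (q : R) (ψ : ℕ → R) : Prop where
  zero : ψ 0 = 1
  succ (m : ℕ) : (1 - q ^ (m + 1)) * ψ (m + 1) = ψ m

/-- The entry `β_r = ∑_{a + k = r} α_k / ((q; q)_{r - k} (q; q)_{r + k + 1})` of the Bailey pair
relative to `q` with first sequence `α`, up to the factor `1 - q`. -/
def baileySum (ψ : ℕ → R) (α : ℕ → R) (r : ℕ) : R :=
  ∑ p ∈ antidiagonal r, α p.2 * (ψ p.1 * ψ (p.1 + 2 * p.2 + 1))

/-- The sequence `α` whose Bailey sums give the principal specialization of `P_{(2^r)}` at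
`t = q ^ N`. -/
def hlAlpha (q : R) (N k : ℕ) : R :=
  (-1) ^ k * q ^ (N * (k + 1).choose 2 + k ^ 2) * (1 - q ^ (2 * k + 1))

variable {q : R} {ψ φ : ℕ → R}

namespace IsInvQPoch

theorem isUnit (h : IsInvQPoch q ψ) (m : ℕ) : IsUnit (ψ m) := by
  induction m with
  | zero => exact h.zero ▸ isUnit_one
  | succ m ih => exact isUnit_of_mul_isUnit_right (h.succ m ▸ ih)

theorem isUnit_one_sub_pow (h : IsInvQPoch q ψ) (m : ℕ) : IsUnit (1 - q ^ (m + 1)) :=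
  isUnit_of_mul_isUnit_left (h.succ m ▸ h.isUnit m)

theorem durfee_rectangle (h : IsInvQPoch q ψ) (m a : ℕ) :
    ∑ p ∈ antidiagonal m, q ^ (p.2 * (p.2 + a)) * (ψ p.1 * ψ p.2 * ψ (p.2 + a)) =
      ψ m * ψ (m + a) := by
  induction m generalizing a with
  | zero => simp [h.zero]
  | succ m ih =>
    refine (h.isUnit_one_sub_pow m).mul_left_cancel ?_
    let T (p : ℕ × ℕ) : R := q ^ (p.2 * (p.2 + a)) * (ψ p.1 * ψ p.2 * ψ (p.2 + a))
    have hsplit : ∀ p ∈ antidiagonal (m + 1), (1 - q ^ (m + 1)) * T p =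
        (1 - q ^ p.1) * T p + q ^ p.1 * (1 - q ^ p.2) * T p := by
      intro p hp
      rw [← mem_antidiagonal.mp hp]
      ring
    have hfst : ∑ p ∈ antidiagonal (m + 1), (1 - q ^ p.1) * T p = ψ m * ψ (m + a) := by
      rw [Finset.Nat.sum_antidiagonal_succ, pow_zero, sub_self, zero_mul, zero_add, ← ih]
      refine Finset.sum_congr rfl fun p _ => ?_
      simp only [T, ← h.succ p.1]
      ring
    have hsnd : ∑ p ∈ antidiagonal (m + 1), q ^ p.1 * (1 - q ^ p.2) * T p =
        q ^ (m + a + 1) * (ψ m * ψ (m + (a + 1))) := by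
      rw [Finset.Nat.sum_antidiagonal_succ', pow_zero, sub_self, mul_zero, zero_mul, zero_add,
        ← ih, Finset.mul_sum]
      refine Finset.sum_congr rfl fun p hp => ?_
      obtain rfl := mem_antidiagonal.mp hp
      simp only [T, ← h.succ p.2, show p.2 + 1 + a = p.2 + (a + 1) by ring]
      ring
    calc (1 - q ^ (m + 1)) * ∑ p ∈ antidiagonal (m + 1), T p
        = ψ m * ψ (m + a) + q ^ (m + a + 1) * (ψ m * ψ (m + (a + 1))) := by
          rw [Finset.mul_sum, Finset.sum_congr rfl hsplit, Finset.sum_add_distrib, hfst, hsnd]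
      _ = (1 - q ^ (m + 1)) * (ψ (m + 1) * ψ (m + 1 + a)) := by
          rw [← mul_assoc (1 - q ^ (m + 1)), h.succ m, ← h.succ (m + a), add_right_comm m 1 a,
            add_assoc m a 1]
          ring

theorem bailey_lemma (h : IsInvQPoch q ψ) (α : ℕ → R) (r : ℕ) :
    ∑ p ∈ antidiagonal r, q ^ (p.2 ^ 2 + p.2) * ψ p.1 * baileySum ψ α p.2 =
      baileySum ψ (fun k => q ^ (k ^ 2 + k) * α k) r := by
  calc ∑ p ∈ antidiagonal r, q ^ (p.2 ^ 2 + p.2) * ψ p.1 * baileySum ψ α p.2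
      = ∑ p ∈ antidiagonal r, ∑ u ∈ antidiagonal p.2, q ^ ((u.1 + u.2) ^ 2 + (u.1 + u.2)) *
          ψ p.1 * (α u.2 * (ψ u.1 * ψ (u.1 + 2 * u.2 + 1))) := by
        simp only [baileySum, Finset.mul_sum]
        refine Finset.sum_congr rfl fun p _ => Finset.sum_congr rfl fun u hu => ?_
        rw [mem_antidiagonal.mp hu]
    _ = ∑ p ∈ antidiagonal r, ∑ u ∈ antidiagonal p.1, q ^ ((u.2 + p.2) ^ 2 + (u.2 + p.2)) *
          ψ u.1 * (α p.2 * (ψ u.2 * ψ (u.2 + 2 * p.2 + 1))) :=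
        sum_antidiagonal_assoc (fun b a k => q ^ ((a + k) ^ 2 + (a + k)) * ψ b *
          (α k * (ψ a * ψ (a + 2 * k + 1)))) r
    _ = baileySum ψ (fun k => q ^ (k ^ 2 + k) * α k) r := by
        refine Finset.sum_congr rfl fun p _ => ?_
        rw [add_assoc p.1, ← h.durfee_rectangle, Finset.mul_sum]
        refine Finset.sum_congr rfl fun u _ => ?_
        rw [← add_assoc u.2]
        ring

theorem baileySum_unit (h : IsInvQPoch q ψ) (r : ℕ) :
    baileySum ψ (fun k => (-1) ^ k * q ^ k.choose 2 * (1 - q ^ (2 * k + 1))) r =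
      if r = 0 then 1 else 0 := by
  rcases r with _ | r
  · simpa [baileySum, h.zero] using h.succ 0
  rw [if_neg r.succ_ne_zero]
  refine (h.isUnit_one_sub_pow r).mul_left_cancel ?_
  let F (a k : ℕ) : R := (-1) ^ k * q ^ k.choose 2 * (1 - q ^ k) * (ψ a * ψ (a + 2 * k))
  let G (a k : ℕ) : R := (-1) ^ (k + 1) * q ^ (k + 1).choose 2 * (1 - q ^ (k + 1)) *
    ((1 - q ^ a) * ψ a * ψ (a + 2 * k + 1))
  have hFG (a k : ℕ) : G (a + 1) k = F a (k + 1) := by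
    simp only [F, G, h.succ a, show a + 1 + 2 * k + 1 = a + 2 * (k + 1) by ring]
  have hterm : ∀ p ∈ antidiagonal (r + 1), (1 - q ^ (r + 1)) *
      ((-1) ^ p.2 * q ^ p.2.choose 2 * (1 - q ^ (2 * p.2 + 1)) *
        (ψ p.1 * ψ (p.1 + 2 * p.2 + 1))) = F p.1 p.2 - G p.1 p.2 := by
    intro p hp
    simp only [F, G, choose_succ_two p.2, ← h.succ (p.1 + 2 * p.2),
      ← mem_antidiagonal.mp hp]
    ring
  rw [baileySum, Finset.mul_sum, Finset.sum_congr rfl hterm, sum_antidiagonal_telescope hFG]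
  simp [F, G]

theorem baileySum_hlAlpha_one (h : IsInvQPoch q ψ) (r : ℕ) :
    baileySum ψ (hlAlpha q 1) r = ψ r := by
  have hα : hlAlpha q 1 =
      fun k => q ^ (k ^ 2 + k) * ((-1) ^ k * q ^ k.choose 2 * (1 - q ^ (2 * k + 1))) := by
    funext k
    rw [hlAlpha, choose_succ_two]
    ring
  simp only [hα, ← h.bailey_lemma, h.baileySum_unit]
  rw [Finset.sum_eq_single_of_mem (r, 0) (by simp)]
  · simp
  · rintro ⟨a, k⟩ hp hne
    have hk : k ≠ 0 := by
      rintro rfl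
      simp_all
    rw [if_neg hk, mul_zero]

theorem one_sub_pow_mul_baileySum_hlAlpha_zero_succ (h : IsInvQPoch q ψ) (r : ℕ) :
    (1 - q ^ (2 * (r + 1))) * baileySum ψ (hlAlpha q 0) (r + 1) =
      baileySum ψ (hlAlpha q 0) r := by
  let T (p : ℕ × ℕ) : R := hlAlpha q 0 p.2 * (ψ p.1 * ψ (p.1 + 2 * p.2 + 1))
  let F (a k : ℕ) : R := (-1) ^ k * q ^ (a + k ^ 2) * (1 - q ^ (2 * k)) * (ψ a * ψ (a + 2 * k))
  let G (a k : ℕ) : R := (-1) ^ (k + 1) * q ^ (a + k ^ 2 + 2 * k) * (1 - q ^ (2 * k + 2)) *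
    ((1 - q ^ a) * ψ a * ψ (a + 2 * k + 1))
  have hFG (a k : ℕ) : G (a + 1) k = F a (k + 1) := by
    simp only [F, G, h.succ a, show a + 1 + 2 * k + 1 = a + 2 * (k + 1) by ring]
    ring
  have hterm : ∀ p ∈ antidiagonal (r + 1), (1 - q ^ (2 * (r + 1))) * T p =
      (1 - q ^ p.1) * (1 - q ^ (p.1 + 2 * p.2 + 1)) * T p + (F p.1 p.2 - G p.1 p.2) := by
    intro p hp
    simp only [T, F, G, hlAlpha, ← h.succ (p.1 + 2 * p.2),
      ← mem_antidiagonal.mp hp]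
    ring
  have hlower : ∑ p ∈ antidiagonal (r + 1),
      (1 - q ^ p.1) * (1 - q ^ (p.1 + 2 * p.2 + 1)) * T p = ∑ p ∈ antidiagonal r, T p := by
    rw [Finset.Nat.sum_antidiagonal_succ, pow_zero, sub_self, zero_mul, zero_mul, zero_add]
    refine Finset.sum_congr rfl fun p _ => ?_
    simp only [T, ← h.succ p.1, ← h.succ (p.1 + 2 * p.2 + 1),
      show p.1 + 1 + 2 * p.2 + 1 = p.1 + 2 * p.2 + 1 + 1 by ring]
    ring
  have hboundary : F (r + 1) 0 - G 0 (r + 1) = 0 := by simp [F, G]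
  calc (1 - q ^ (2 * (r + 1))) * ∑ p ∈ antidiagonal (r + 1), T p
      = ∑ p ∈ antidiagonal r, T p + (F (r + 1) 0 - G 0 (r + 1)) := by
        rw [Finset.mul_sum, Finset.sum_congr rfl hterm, Finset.sum_add_distrib, hlower,
          sum_antidiagonal_telescope hFG]
    _ = ∑ p ∈ antidiagonal r, T p := by rw [hboundary, add_zero]

theorem baileySum_hlAlpha_zero (h : IsInvQPoch q ψ) (hφ : IsInvQPoch (q ^ 2) φ) (r : ℕ) :
    baileySum ψ (hlAlpha q 0) r = φ r := by
  induction r with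
  | zero => simpa [baileySum, hlAlpha, h.zero, hφ.zero] using h.succ 0
  | succ r ih =>
    refine (hφ.isUnit_one_sub_pow r).mul_left_cancel ?_
    rw [hφ.succ, ← ih, ← pow_mul, h.one_sub_pow_mul_baileySum_hlAlpha_zero_succ]

theorem baileySum_hlAlpha_add_two (h : IsInvQPoch q ψ) (N r : ℕ) :
    baileySum ψ (hlAlpha q (N + 2)) r =
      ∑ p ∈ antidiagonal r, q ^ (p.2 ^ 2 + p.2) * ψ p.1 * baileySum ψ (hlAlpha q N) p.2 := by
  have htriangle (k : ℕ) : 2 * (k + 1).choose 2 = k ^ 2 + k := by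
    rw [two_mul_choose_two]
    exact Nat.sub_eq_of_eq_add (by ring)
  rw [h.bailey_lemma]
  congr 1
  funext k
  rw [hlAlpha, hlAlpha, add_mul N 2, htriangle]
  ring

end IsInvQPoch

end Bailey

section PrincipalSpecialization

variable {R : Type*} [CommRing R] {q : R} {ψ : ℕ → R}

/-- Splitting off the first and the last of the variables `1, q, …, q ^ k` gives two recurrences,
whose difference is the claim. -/
theorem one_sub_pow_mul_esymm_pow_succ (q : R) (k a : ℕ) :
    (1 - q ^ (a + 1)) * (Finset.univ.val.map fun i : Fin k => q ^ (i : ℕ)).esymm (a + 1) =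
      (q ^ a - q ^ k) * (Finset.univ.val.map fun i : Fin k => q ^ (i : ℕ)).esymm a := by
  have hlast : (Finset.univ.val.map fun i : Fin (k + 1) => q ^ (i : ℕ)) =
      q ^ k ::ₘ Finset.univ.val.map fun i : Fin k => q ^ (i : ℕ) := by
    simp [Fin.univ_castSuccEmb, Function.comp_def]
  have hfirst : (Finset.univ.val.map fun i : Fin (k + 1) => q ^ (i : ℕ)) =
      1 ::ₘ (Finset.univ.val.map fun i : Fin k => q ^ (i : ℕ)).map (q • ·) := by
    simp [Fin.univ_val_map, List.ofFn_succ, pow_succ', Function.comp_def]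
  have h := congrArg (Multiset.esymm · (a + 1)) (hlast.symm.trans hfirst)
  simp only [esymm_cons, one_mul] at h
  rw [← Multiset.pow_smul_esymm, ← Multiset.pow_smul_esymm, smul_eq_mul, smul_eq_mul] at h
  linear_combination h

namespace IsInvQPoch

theorem pow_dvd_esymm_pow_sub (h : IsInvQPoch q ψ) (k a : ℕ) :
    q ^ k ∣ (Finset.univ.val.map fun i : Fin k => q ^ (i : ℕ)).esymm a - q ^ a.choose 2 * ψ a := by
  induction a with
  | zero => simp [esymm_zero, h.zero]
  | succ a ih =>
    have hstep : (1 - q ^ (a + 1)) *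
        ((Finset.univ.val.map fun i : Fin k => q ^ (i : ℕ)).esymm (a + 1) -
          q ^ (a + 1).choose 2 * ψ (a + 1)) =
        q ^ a * ((Finset.univ.val.map fun i : Fin k => q ^ (i : ℕ)).esymm a -
          q ^ a.choose 2 * ψ a) -
        q ^ k * (Finset.univ.val.map fun i : Fin k => q ^ (i : ℕ)).esymm a := by
      rw [mul_sub, one_sub_pow_mul_esymm_pow_succ, mul_left_comm, h.succ, choose_succ_two]
      ring
    rw [← (h.isUnit_one_sub_pow a).dvd_mul_left, hstep]
    exact dvd_sub (ih.mul_left _) (dvd_mul_right _ _)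

theorem twoColSchur_eq (h : IsInvQPoch q ψ) (a m : ℕ) :
    twoColSchur (fun i => q ^ i.choose 2 * ψ i) a (a + m) =
      q ^ (a.choose 2 + (a + m).choose 2) * (1 - q ^ (m + 1)) * (ψ a * ψ (a + m + 1)) := by
  cases a with
  | zero =>
    simp only [twoColSchur, zero_add, Nat.choose_zero_succ, ← h.succ m]
    ring
  | succ a =>
    simp only [twoColSchur, ← h.succ a, ← h.succ (a + 1 + m), choose_succ_two a,
      choose_succ_two (a + 1 + m)]
    ring

theorem twoColSum_eq (h : IsInvQPoch q ψ) (N r : ℕ) :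
    twoColSum (fun i => q ^ i.choose 2 * ψ i) (q ^ N) r =
      q ^ (r ^ 2 - r) * baileySum ψ (hlAlpha q N) r := by
  rw [twoColSum, baileySum, Finset.mul_sum]
  refine Finset.sum_congr rfl fun p hp => ?_
  obtain rfl := mem_antidiagonal.mp hp
  rw [h.twoColSchur_eq, choose_two_add_choose_two, hlAlpha, ← pow_mul]
  ring

end IsInvQPoch

end PrincipalSpecialization

section RectangularPartition

variable {k : ℕ}

/-- The sequence with value `c` on `J` and `0` elsewhere: up to the order of its entries, the
partition `(c^r)` with `r = |J|`. -/
def rectOn (c : ℕ) (J : Finset (Fin k)) (i : Fin k) : ℕ := if i ∈ J then c else 0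

variable {c : ℕ}

theorem term_rectOn (hc : 0 < c) (J : Finset (Fin k)) (w : Equiv.Perm (Fin k)) :
    term (rectOn c J) w = rectTerm x (t k) c Finset.univ (J.map w.toEmbedding) := by
  have hpairs :
      ({p | rectOn c J p.2 < rectOn c J p.1} : Finset (Fin k × Fin k)) = J ×ˢ Jᶜ := by
    ext p
    rw [Finset.mem_filter_univ]
    by_cases h1 : p.1 ∈ J <;> by_cases h2 : p.2 ∈ J <;> simp [rectOn, h1, h2, hc]
  have hcompl : Finset.univ \ J.map w.toEmbedding = Jᶜ.map w.toEmbedding := by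
    rw [Finset.compl_eq_univ_sdiff, Finset.map_sdiff, Finset.map_univ_equiv]
  have hpow (i : Fin k) : x (w i) ^ rectOn c J i = if i ∈ J then x (w i) ^ c else 1 := by
    rw [rectOn, pow_ite, pow_zero]
  rw [term, hpairs, Finset.prod_product, rectTerm, hcompl]
  simp only [Finset.prod_map, Equiv.coe_toEmbedding, hpow, Finset.prod_ite_mem, Finset.univ_inter,
    Finset.prod_mul_distrib]

theorem map_eq_map_iff_inv_mul_mem_stab (hc : 0 < c) (J : Finset (Fin k))
    (v w : Equiv.Perm (Fin k)) :
    J.map v.toEmbedding = J.map w.toEmbedding ↔ v⁻¹ * w ∈ stab (rectOn c J) := by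
  have hrect (i j : Fin k) : rectOn c J i = rectOn c J j ↔ (i ∈ J ↔ j ∈ J) := by
    simp only [rectOn]
    grind
  change _ ↔ ∀ i, rectOn c J ((v⁻¹ * w) i) = rectOn c J i
  simp only [hrect, Finset.ext_iff, Finset.mem_map_equiv]
  rw [w.symm.forall_congr_left]
  simp [Equiv.Perm.inv_def]

theorem exists_perm_map_eq {ι : Type*} [Finite ι] {I J : Finset ι} (h : I.card = J.card) :
    ∃ w : Equiv.Perm ι, J.map w.toEmbedding = I := by
  have e : {i // i ∈ J} ≃ {i // i ∈ I} := Fintype.equivOfCardEq (by simp [h])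
  classical
  cases nonempty_fintype ι
  refine ⟨e.extendSubtype, Finset.eq_of_subset_of_card_le (fun i hi => ?_) (by simp [h])⟩
  obtain ⟨j, hj, rfl⟩ := Finset.mem_map.mp hi
  exact e.extendSubtype_mem j hj

theorem ratP_rectOn (hc : 0 < c) (J : Finset (Fin k)) :
    ratP (rectOn c J) = rectSum x (t k) c Finset.univ J.card := by
  classical
  refine Finset.sum_bij (fun C _ => Quotient.liftOn' C (fun w => J.map w.toEmbedding)
    fun v w h => (map_eq_map_iff_inv_mul_mem_stab hc J v w).mpr (QuotientGroup.leftRel_apply.mp h))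
    ?_ ?_ ?_ ?_
  · rintro ⟨w⟩ _
    exact Finset.mem_powersetCard.mpr ⟨Finset.subset_univ _, Finset.card_map _⟩
  · rintro ⟨v⟩ _ ⟨w⟩ _ h
    exact QuotientGroup.eq.mpr ((map_eq_map_iff_inv_mul_mem_stab hc J v w).mp h)
  · intro I hI
    obtain ⟨w, hw⟩ := exists_perm_map_eq (Finset.mem_powersetCard.mp hI).2
    exact ⟨w, Finset.mem_univ _, hw⟩
  · rintro ⟨w⟩ _
    exact term_rectOn hc J w

end RectangularPartition

section SchurExpansion

variable {k : ℕ}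

theorem x_injective : Function.Injective (x : Fin k → RatFun k) :=
  (IsFractionRing.injective (Poly k) (RatFun k)).comp MvPolynomial.X_injective

theorem x_ne_zero (i : Fin k) : x i ≠ 0 :=
  (IsFractionRing.to_map_eq_zero_iff.not).mpr (MvPolynomial.X_ne_zero i)

theorem t_pow_succ_ne_one (m : ℕ) : t k ^ (m + 1) ≠ 1 := by
  have hX : (Polynomial.X : Polynomial ℤ) ^ (m + 1) ≠ 1 := fun h => by
    simpa using congrArg Polynomial.natDegree h
  have hinj := (IsFractionRing.injective (Poly k) (RatFun k)).comp
    (MvPolynomial.C_injective (Fin k) (Polynomial ℤ))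
  simpa [t] using hinj.ne hX

/-- The polynomial `P_{(2^r)}(x₁, …, x_k; t)` in Schur expansion. -/
noncomputable def twoColPoly (k r : ℕ) : Poly k :=
  twoColSum (MvPolynomial.esymm (Fin k) (Polynomial ℤ)) (MvPolynomial.C Polynomial.X) r

theorem map_twoColPoly {S : Type*} [CommRing S] (f : Poly k →+* S) (r : ℕ) :
    f (twoColPoly k r) = twoColSum (Finset.univ.val.map fun i => f (MvPolynomial.X i)).esymm
      (f (MvPolynomial.C Polynomial.X)) r := by
  rw [twoColPoly, map_twoColSum]
  congr 1
  funext a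
  rw [MvPolynomial.esymm_eq_multiset_esymm, map_esymm, Multiset.map_map, Function.comp_def]

theorem polyP_rectOn_two (J : Finset (Fin k)) : polyP (rectOn 2 J) = twoColPoly k J.card := by
  apply IsFractionRing.injective (Poly k) (RatFun k)
  rw [algebraMap_polyP, ratP_rectOn two_pos, map_twoColPoly]
  exact rectSum_two_eq_twoColSum t_pow_succ_ne_one x_injective.injOn (fun i _ => x_ne_zero i) _

theorem mem_twoPow {r i j : ℕ} : (i, j) ∈ twoPow r ↔ i < r ∧ j < 2 := by
  simp [twoPow, YoungDiagram.mem_ofRowLens]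

theorem rowLen_twoPow (r i : ℕ) : (twoPow r).rowLen i = if i < r then 2 else 0 := by
  refine eq_of_forall_lt_iff fun j => ?_
  rw [← YoungDiagram.mem_iff_lt_rowLen, mem_twoPow]
  split_ifs with h <;> simp [h]

theorem colLen_twoPow (r : ℕ) : (twoPow r).colLen 0 = r := by
  refine eq_of_forall_lt_iff fun i => ?_
  simp [← YoungDiagram.mem_iff_lt_colLen, mem_twoPow]

theorem polyP_rowLen_twoPow {r : ℕ} (h : r ≤ k) :
    polyP (fun i : Fin k => (twoPow r).rowLen i) = twoColPoly k r := by
  have hrect : (fun i : Fin k => (twoPow r).rowLen i) = rectOn 2 {i : Fin k | (i : ℕ) < r} := by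
    funext i
    simp [rectOn, rowLen_twoPow]
  rw [hrect, polyP_rectOn_two, Fin.card_filter_val_lt, min_eq_right h]

theorem killCompl_esymm {σ τ R : Type*} [CommSemiring R] [Fintype σ] [Fintype τ] {f : σ → τ}
    (hf : Function.Injective f) (a : ℕ) :
    MvPolynomial.killCompl hf (MvPolynomial.esymm τ R a) = MvPolynomial.esymm σ R a := by
  rw [MvPolynomial.killCompl, MvPolynomial.aeval_esymm_eq_multiset_esymm,
    MvPolynomial.esymm_eq_multiset_esymm,
    esymm_map_eq_of_subset (Finset.subset_univ (Finset.univ.map ⟨f, hf⟩))]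
  · simp
  · intro i _ hi
    rw [dif_neg]
    simpa using hi

theorem killCompl_twoColPoly {l : ℕ} {f : Fin k → Fin l} (hf : Function.Injective f) (r : ℕ) :
    MvPolynomial.killCompl hf (twoColPoly l r) = twoColPoly k r := by
  have h := map_twoColSum (MvPolynomial.killCompl (R := Polynomial ℤ) hf).toRingHom
    (MvPolynomial.esymm (Fin l) (Polynomial ℤ)) (MvPolynomial.C Polynomial.X) r
  simpa [killCompl_esymm, MvPolynomial.killCompl_C, twoColPoly] using h

theorem coeff_mapDomain_symP_twoPow {r : ℕ} (h : r ≤ k) (m : Fin k →₀ ℕ) :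
    MvPowerSeries.coeff (m.mapDomain Fin.val) (symP (twoPow r)) =
      MvPolynomial.coeff m (twoColPoly k r) := by
  set M : ℕ →₀ ℕ := m.mapDomain Fin.val
  set l := max r (M.support.sup (· + 1))
  have hlk : l ≤ k := by
    refine max_le h (Finset.sup_le fun i hi => ?_)
    obtain ⟨j, -, rfl⟩ := Finset.mem_image.mp (Finsupp.mapDomain_support hi)
    exact j.2
  have hrange : (M.support : Set ℕ) ⊆ Set.range (Fin.val : Fin l → ℕ) := by
    intro i hi
    exact ⟨⟨i, lt_max_of_lt_right (Finset.le_sup (f := (· + 1)) hi)⟩, rfl⟩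
  have hm : (M.comapDomain Fin.val Fin.val_injective.injOn).mapDomain (Fin.castLE hlk) = m := by
    apply Finsupp.mapDomain_injective Fin.val_injective
    rw [← Finsupp.mapDomain_comp]
    exact Finsupp.mapDomain_comapDomain _ Fin.val_injective M hrange
  change MvPolynomial.coeff (M.comapDomain Fin.val Fin.val_injective.injOn)
    (polyP fun i : Fin (max ((twoPow r).colLen 0) (M.support.sup (· + 1))) =>
      (twoPow r).rowLen i) = _
  rw [colLen_twoPow, polyP_rowLen_twoPow (le_max_left _ _),
    ← killCompl_twoColPoly (Fin.castLE_injective hlk), MvPolynomial.coeff_killCompl, hm]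

end SchurExpansion

open PowerSeries (X)

section Multisum

theorem isInvQPoch_invQPoch {b : ℕ} (hb : 0 < b) :
    IsInvQPoch ((X : PowerSeries ℤ) ^ b) fun m : ℕ => invQPoch b m := by
  have hnat (m : ℕ) : invQPoch b m = Ring.inverse (qPoch (X ^ b) (X ^ b) m) := by
    rw [invQPoch, if_pos (Int.natCast_nonneg m), Int.toNat_natCast]
  have hsucc (m : ℕ) : qPoch (X ^ b) (X ^ b) (m + 1) =
      (1 - (X ^ b) ^ (m + 1)) * qPoch (X ^ b) (X ^ b) m := by
    rw [qPoch, Finset.prod_range_succ, ← pow_succ', mul_comm, qPoch]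
  refine ⟨?_, fun m => ?_⟩
  · simp only [hnat, qPoch, Finset.prod_range_zero, Ring.inverse_one]
  · have hunit : IsUnit (1 - (X ^ b : PowerSeries ℤ) ^ (m + 1)) :=
      isUnit_of_mul_isUnit_left (hsucc m ▸ isUnit_qPoch hb (m + 1))
    simp only [hnat]
    rw [hsucc, Ring.mul_inverse_rev, mul_left_comm, Ring.mul_inverse_cancel _ hunit, mul_one]

theorem isInvQPoch_invQPoch_one :
    IsInvQPoch (X : PowerSeries ℤ) fun m : ℕ => invQPoch 1 m := by
  simpa using isInvQPoch_invQPoch one_pos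

theorem finsum_invQPoch_sub_mul (b r : ℕ) (g : ℕ → PowerSeries ℤ) :
    ∑ᶠ s : ℕ, invQPoch b ((r : ℤ) - s) * g s =
      ∑ p ∈ antidiagonal r, invQPoch b p.1 * g p.2 := by
  rw [finsum_eq_sum_of_support_subset _ (s := Finset.range (r + 1)),
    ← Finset.Nat.sum_antidiagonal_swap, Finset.Nat.sum_antidiagonal_eq_sum_range_succ_mk]
  · refine Finset.sum_congr rfl fun s hs => ?_
    simp only [Prod.swap_prod_mk]
    rw [Nat.cast_sub (Finset.mem_range_succ_iff.mp hs)]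
  · intro s hs
    contrapose! hs
    have hneg : ¬(0 : ℤ) ≤ r - s := by
      simp only [Finset.coe_range, Set.mem_Iio] at hs
      omega
    rw [Function.notMem_support, invQPoch, if_neg hneg, zero_mul]

theorem finsum_fin_succ {M : Type*} [AddCommMonoid M] {n : ℕ} (f : (Fin (n + 1) → ℕ) → M)
    (hf : (Function.support f).Finite) :
    ∑ᶠ ρ, f ρ = ∑ᶠ (s : ℕ) (ρ : Fin n → ℕ), f (Fin.cons s ρ) := by
  rw [← finsum_comp_equiv (Fin.consEquiv fun _ => ℕ)]
  exact finsum_curry _ (hf.preimage (Fin.consEquiv fun _ => ℕ).injective.injOn)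

theorem summand_cons (r n b s : ℕ) (ρ : Fin n → ℕ) :
    summand r (n + 1) b (Fin.cons s ρ) =
      X ^ (r ^ 2 - r) * (invQPoch 1 ((r : ℤ) - s) * (X ^ (2 * s) * summand s n b ρ)) := by
  have hs : s ^ 2 + s = 2 * s + (s ^ 2 - s) := by
    have := Nat.le_self_pow two_ne_zero s
    omega
  simp only [summand, Fin.sum_univ_succ, Fin.prod_univ_succ, Fin.cons_succ, Fin.cons_zero,
    Fin.castSucc_zero, ← Fin.succ_castSucc, ← Fin.succ_last, hs, pow_add]
  ring

theorem finsum_summand_succ (r n b : ℕ) :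
    ∑ᶠ ρ, summand r (n + 1) b ρ = X ^ (r ^ 2 - r) *
      ∑ p ∈ antidiagonal r, invQPoch 1 p.1 * (X ^ (2 * p.2) * ∑ᶠ ρ, summand p.2 n b ρ) := by
  rw [finsum_fin_succ _ (finite_support_summand r (n + 1) b)]
  simp only [summand_cons, ← mul_finsum]
  rw [finsum_invQPoch_sub_mul]

theorem finsum_summand {δ : ℕ} (hδ : δ = 0 ∨ δ = 1) (n r : ℕ) :
    ∑ᶠ ρ, summand r n (2 - δ) ρ =
      X ^ (r ^ 2 - r) * baileySum (fun m : ℕ => invQPoch 1 m) (hlAlpha X (2 * n + δ)) r := by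
  induction n generalizing r with
  | zero =>
    have hbase : baileySum (fun m : ℕ => invQPoch 1 m) (hlAlpha X δ) r = invQPoch (2 - δ) r := by
      rcases hδ with rfl | rfl
      · exact isInvQPoch_invQPoch_one.baileySum_hlAlpha_zero (isInvQPoch_invQPoch two_pos) r
      · exact isInvQPoch_invQPoch_one.baileySum_hlAlpha_one r
    simp [finsum_unique, summand, hbase]
  | succ n ih =>
    rw [finsum_summand_succ, show 2 * (n + 1) + δ = 2 * n + δ + 2 by ring,
      isInvQPoch_invQPoch_one.baileySum_hlAlpha_add_two]
    refine congrArg _ (Finset.sum_congr rfl fun p _ => ?_)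
    have hs : 2 * p.2 + (p.2 ^ 2 - p.2) = p.2 ^ 2 + p.2 := by
      have := Nat.le_self_pow two_ne_zero p.2
      omega
    rw [ih, ← mul_assoc (X ^ _), ← pow_add, hs]
    ring

end Multisum

section Convergence

/-- The substitution `x_i ↦ q ^ (i - 1)`, `t ↦ T` into a polynomial in `x₁, …, x_k`. -/
noncomputable def principalEval (T : PowerSeries ℤ) (k : ℕ) : Poly k →+* PowerSeries ℤ :=
  MvPolynomial.eval₂Hom (Polynomial.aeval T).toRingHom fun i => X ^ (i : ℕ)

theorem principalEval_twoColPoly (T : PowerSeries ℤ) (k r : ℕ) :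
    principalEval T k (twoColPoly k r) =
      twoColSum (Finset.univ.val.map fun i : Fin k => (X : PowerSeries ℤ) ^ (i : ℕ)).esymm T r := by
  simp [map_twoColPoly, principalEval]

theorem X_pow_dvd_prod_X_pow_pow {m : ℕ →₀ ℕ} {i : ℕ} (hi : i ∈ m.support) :
    (X : PowerSeries ℤ) ^ i ∣ m.prod fun j e => (X ^ j) ^ e :=
  (dvd_pow_self _ (Finsupp.mem_support_iff.mp hi)).trans (Finset.dvd_prod_of_mem _ hi)

theorem hasSum_coeff_principalEval {F : MvPowerSeries ℕ (Polynomial ℤ)} {d k : ℕ} (hd : d < k)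
    {P : Poly k}
    (hP : ∀ m : Fin k →₀ ℕ, MvPowerSeries.coeff (m.mapDomain Fin.val) F = MvPolynomial.coeff m P)
    (T : PowerSeries ℤ) :
    HasSum (fun m : ℕ →₀ ℕ => PowerSeries.coeff d (Polynomial.aeval T (MvPowerSeries.coeff m F) *
        m.prod fun i e => ((X : PowerSeries ℤ) ^ i) ^ e))
      (PowerSeries.coeff d (principalEval T k P)) := by
  have hinj : Function.Injective (Finsupp.mapDomain (M := ℕ) (Fin.val : Fin k → ℕ)) :=
    Finsupp.mapDomain_injective Fin.val_injective
  have hsum : principalEval T k P = ∑ m ∈ P.support.map ⟨_, hinj⟩,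
      Polynomial.aeval T (MvPowerSeries.coeff m F) * m.prod fun i e => (X ^ i) ^ e := by
    rw [principalEval, MvPolynomial.coe_eval₂Hom, MvPolynomial.eval₂_eq, Finset.sum_map]
    refine Finset.sum_congr rfl fun m _ => ?_
    rw [Function.Embedding.coeFn_mk, hP, Finsupp.prod_mapDomain_index_inj Fin.val_injective]
    rfl
  rw [hsum, map_sum]
  refine hasSum_sum_of_ne_finset_zero fun m hm => ?_
  by_cases hrange : (m.support : Set ℕ) ⊆ Set.range (Fin.val : Fin k → ℕ)
  · obtain ⟨u, rfl⟩ : ∃ u : Fin k →₀ ℕ, u.mapDomain Fin.val = m :=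
      ⟨_, Finsupp.mapDomain_comapDomain _ Fin.val_injective m hrange⟩
    have hu : u ∉ P.support := fun hu => hm (Finset.mem_map_of_mem ⟨_, hinj⟩ hu)
    rw [hP, MvPolynomial.notMem_support_iff.mp hu, map_zero, zero_mul, map_zero]
  · obtain ⟨i, hi, hik⟩ := Set.not_subset.mp hrange
    have hki : k ≤ i := by simpa using hik
    exact PowerSeries.X_pow_dvd_iff.mp ((X_pow_dvd_prod_X_pow_pow hi).mul_left _) d
      (hd.trans_le hki)

theorem hasPrincipalSpecialization_of_principalEval {F : MvPowerSeries ℕ (Polynomial ℤ)}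
    {T s : PowerSeries ℤ} {k₀ : ℕ} {P : ∀ k, Poly k}
    (hP : ∀ k, k₀ ≤ k → ∀ m : Fin k →₀ ℕ,
      MvPowerSeries.coeff (m.mapDomain Fin.val) F = MvPolynomial.coeff m (P k))
    (hs : ∀ k, X ^ k ∣ principalEval T k (P k) - s) : HasPrincipalSpecialization F T s := by
  refine (PowerSeries.WithPiTopology.hasSum_iff_hasSum_coeff ℤ).mpr fun d => ?_
  have hd : d < max k₀ (d + 1) := lt_max_of_lt_right d.lt_succ_self
  have hcoeff := PowerSeries.X_pow_dvd_iff.mp (hs (max k₀ (d + 1))) d hd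
  rw [map_sub, sub_eq_zero] at hcoeff
  exact hcoeff ▸ hasSum_coeff_principalEval hd (hP _ (le_max_left _ _)) T

theorem hasPrincipalSpecialization_symP_twoPow (r N : ℕ) :
    HasPrincipalSpecialization (symP (twoPow r)) (X ^ N)
      (X ^ (r ^ 2 - r) * baileySum (fun m : ℕ => invQPoch 1 m) (hlAlpha X N) r) := by
  refine hasPrincipalSpecialization_of_principalEval
    (fun k hk => coeff_mapDomain_symP_twoPow hk) fun k => ?_
  rw [principalEval_twoColPoly, ← isInvQPoch_invQPoch_one.twoColSum_eq]
  exact dvd_twoColSum_sub_twoColSum (isInvQPoch_invQPoch_one.pow_dvd_esymm_pow_sub k) _ r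

end Convergence

end HallLittlewood

theorem mainTheorem7 (r n δ : ℕ) (hδ : δ = 0 ∨ δ = 1) :
    HallLittlewood.HasPrincipalSpecialization
      (HallLittlewood.symP (HallLittlewood.twoPow r))
      ((PowerSeries.X : PowerSeries ℤ) ^ (2 * n + δ))
      (∑ᶠ ρ : Fin n → ℕ, HallLittlewood.summand r n (2 - δ) ρ) := by
  rw [HallLittlewood.finsum_summand hδ]
  exact HallLittlewood.hasPrincipalSpecialization_symP_twoPow r (2 * n + δ)
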